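/- **Setting.** Let $R=K[x_1,\dots,x_n]$ be a polynomial ring over a field $K$, with a monomial order $<$ on its set $\mathbb M$ of monomials that is degree-compatible ($\deg s<\deg t$ implies $s<t$). For $p\neq0$ write $\mathrm{lm}(p),\mathrm{lc}(p),\mathrm{lt}(p)$ for its leading monomial, coefficient and term, and $t_{p,q}=\mathrm{lcm}(\mathrm{lm}(p),\mathrm{lm}(q))$. The S-polynomial is $S(p,q)=\frac{t_{p,q}}{\mathrm{lm}(p)}p-\frac{\mathrm{lc}(p)}{\mathrm{lc}(q)}\frac{t_{p,q}}{\mathrm{lm}(q)}q$. Let $i\ge 0$ and $f_1,\dots,f_{i+1}\in R$ be such that $f_j\notin\langle f_1,\dots,f_{j-1}\rangle$ for all $j\le i+1$ and $\{f_1,\dots,f_i\}$ is a Gröbner basis of $I_i=\langle f_1,\dots,f_i\rangle$. Put $I_{i+1}=\langle f_1,\dots,f_{i+1}\rangle$, and let $e_1,\dots,e_{i+1}$ be the standard basis of $R^{i+1}$. **Signatures.** $c\tau e_j$ (with $c\in K\setminus\{0\}$, $\tau\in\mathbb M$) is a signature of $p$ if $p=h_1f_1+\dots+h_jf_j$ for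 some $h_k\in R$ with $h_j\ne0$ and $\mathrm{lt}(h_j)=c\tau$. Monic signatures are ordered by $\sigma e_j<\tau e_k$ iff $j<k$, or $j=k$ and $\sigma<\tau$. $\mathrm{minsig}(p)$ is the least $\tau e_j$ such that some $c\tau e_j$ is a signature of $p$. For a finite set $G$ of pairs $(\tau e_j,g)$ with $\tau e_j=\mathrm{minsig}(g)$, the pair $(c\sigma e_{i+1},s)$ has a standard representation with respect to $G$ if $c\sigma e_{i+1}$ is a signature of $s$ and $s=\sum_{(\tau e_j,g)\in G}h_g\,g$ where, for every $g$, either $h_g=0$, or $s\neq 0$, $\mathrm{lm}(h_g)\mathrm{lm}(g)\le\mathrm{lm}(s)$ and $\mathrm{lm}(h_g)\tau e_j\le\sigma e_{i+1}$. **Reduction.** Let $r\ne0$ carry the signature $c\sigma e_{i+1}$, let $(\tau e_k,g)$ be in a list $G$ with $g\ne0$, and let $a\in K$, $t\in\mathbb M$ with $at\,\mathrm{lt}(g)=\mathrm{lt}(r)$. Replacing $r$ by $r-atg$ is a $\sigma$-reduction of type (A) if $t\tau e_k<\sigma e_{i+1}$ (the signature remains $c\sigma e_{i+1}$), and of type (B)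 if $t\tau e_k=\sigma e_{i+1}$ and $a\ne c$ (the signature becomes $(c-a)\sigma e_{i+1}$). A semi-complete $\sigma$-reduction of $s$ modulo $G$ is a chain of such reductions, starting from $s$ with signature $\sigma e_{i+1}$ and stopping at an element that admits no reduction of type (A); the final element is divided by the coefficient of its signature. **Redundancy.** $(\sigma e_{i+1},f)$ is signature-redundant to $G$ if there is $(\tau e_{i+1},g)\in G$, $g\ne0$, with $\tau\mid\sigma$ and $\mathrm{lm}(g)\mid\mathrm{lm}(f)$. An element of the list $G$ below is called *active* if it is nonzero and was not signature-redundant, when it was appended, to the elements already in $G$. The initial elements are active. **Algorithm.** Start with the list $G=\big((e_1,f_1),\dots,(e_{i+1},f_{i+1})\big)$ and $P=\big\{\big(\tfrac{t_{f_{i+1},f_j}}{\mathrm{lm}(f_{i+1})}e_{i+1},f_{i+1},f_j\big):1\le j\le i\big\}$. While $P\ne\emptyset$: let $d$ be the minimal degree of $\sigma$ over all $(\sigma e_{i+1},p,q)\in P$, and move all elements of $P$ with $\deg\sigma=d$ to a set $S$. While $S\neq\emptyset$: 1. Remove from $S$ some $(\sigma e_{i+1},p,q)$ with $\sigma$ minimal.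 2. Let $r$ be the result of some semi-complete $\sigma$-reduction of $S(p,q)$ modulo $G$. 3. If $r\neq0$ and $(\sigma e_{i+1},r)$ is not signature-redundant to $G$, then for each active $(\tau e_j,g)\in G$ with $\frac{t_{r,g}}{\mathrm{lm}(r)}\sigma e_{i+1}\ne\frac{t_{r,g}}{\mathrm{lm}(g)}\tau e_j$ form a new pair. It is $\big(\frac{t_{r,g}}{\mathrm{lm}(r)}\sigma e_{i+1},r,g\big)$ if the first of these two signatures is larger, and $\big(\frac{t_{r,g}}{\mathrm{lm}(g)}\tau e_{j},g,r\big)$ otherwise. Put it in $S$ if its signature monomial has degree $d$, and in $P$ otherwise. 4. Append $(\sigma e_{i+1},r)$ to $G$. When $P=\emptyset$, return the set $\widetilde G$ of active elements of $G$. **Theorem.** For all choices made in steps 1 and 2: * *Termination.* There is no infinite run (each single reduction counting as a step), and a run never gets stuck: it can always be continued until the algorithm returns. * *Correctness.* The output $\widetilde G$ satisfies: * all $g$ with $(\sigma e_j,g)\in\widetilde G$ are nonzero elements of $I_{i+1}$; * the $g$ with $(\sigma e_j,g)\in\widetilde G$ and $j\le i$ form a Gröbner basis of $I_i$; * $(e_{i+1},f_{i+1})\in\widetilde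 G$; * $\sigma e_j=\mathrm{minsig}(g)$ for all $(\sigma e_j,g)\in\widetilde G$; * for all $(\sigma e_{i+1},p),(\tau e_j,q)\in\widetilde G$ with $\frac{t_{p,q}}{\mathrm{lm}(p)}\sigma e_{i+1}>\frac{t_{p,q}}{\mathrm{lm}(q)}\tau e_j$, the pair $\big(\frac{t_{p,q}}{\mathrm{lm}(p)}\sigma e_{i+1},S(p,q)\big)$ has a standard representation with respect to $\widetilde G$. Moreover $\{g:(\sigma e_j,g)\in\widetilde G\}$ is a Gröbner basis of $I_{i+1}$. -/

import Mathlib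

open scoped MonomialOrder

namespace SigGB

noncomputable section

open MvPolynomial
open scoped Classical

/-- The module monomial `mon • e_idx` (a monic signature) of the free module `R ^ (i + 1)`. The
position `Fin.last i` is the position of the last generator. -/
structure MonSig (n i : ℕ) where
  mon : Fin n →₀ ℕ
  idx : Fin (i + 1)

/-- The order on monic signatures: first by position, then by monomial. -/
def MonSig.LT {n i : ℕ} (m : MonomialOrder (Fin n)) (s t : MonSig n i) : Prop :=
  s.idx < t.idx ∨ (s.idx = t.idx ∧ s.mon ≺[m] t.mon)

def MonSig.LE {n i : ℕ} (m : MonomialOrder (Fin n)) (s t : MonSig n i) : Prop :=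
  s = t ∨ s.LT m t

/-- Multiplication of a monic signature by a monomial. -/
def MonSig.mul {n i : ℕ} (u : Fin n →₀ ℕ) (s : MonSig n i) : MonSig n i :=
  ⟨u + s.mon, s.idx⟩

/-- A polynomial labelled by a monic signature. -/
structure Labeled (K : Type*) [Field K] (n i : ℕ) where
  sig : MonSig n i
  poly : MvPolynomial (Fin n) K

/-- A critical pair `(mon • e_{i+1}, left, right)`. -/
structure CritPair (K : Type*) [Field K] (n : ℕ) where
  mon : Fin n →₀ ℕ
  left : MvPolynomial (Fin n) K
  right : MvPolynomial (Fin n) K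

section

variable {K : Type*} [Field K] {n i : ℕ} (m : MonomialOrder (Fin n))

/-- The ordering refines the total degree. -/
def DegreeCompatible : Prop :=
  ∀ a b : Fin n →₀ ℕ, a.degree < b.degree → a ≺[m] b

/-- `B` is a Gröbner basis of the ideal `I`. For monomials, `≤` on exponents is divisibility. -/
def IsGroebnerBasis (B : Set (MvPolynomial (Fin n) K)) (I : Ideal (MvPolynomial (Fin n) K)) :
    Prop :=
  (∀ g ∈ B, g ∈ I) ∧ ∀ p ∈ I, p ≠ 0 → ∃ g ∈ B, g ≠ 0 ∧ m.degree g ≤ m.degree p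

/-- The first `i` of the `i + 1` generators. -/
def initialGens (F : Fin (i + 1) → MvPolynomial (Fin n) K) : Set (MvPolynomial (Fin n) K) :=
  Set.range fun j : Fin i => F j.castSucc

/-- The least common multiple of the leading monomials of `p` and `q`. -/
def lcmLM (p q : MvPolynomial (Fin n) K) : Fin n →₀ ℕ :=
  m.degree p ⊔ m.degree q

/-- The cofactor `lcm(lm p, lm q) / lm p`. -/
def cofactor (p q : MvPolynomial (Fin n) K) : Fin n →₀ ℕ :=
  lcmLM m p q - m.degree p

/-- The S-polynomial, in the normalization where only `q` is multiplied by a scalar. -/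
def spoly (p q : MvPolynomial (Fin n) K) : MvPolynomial (Fin n) K :=
  monomial (cofactor m p q) 1 * p
    - monomial (cofactor m q p) (m.leadingCoeff p / m.leadingCoeff q) * q

/-! ### Signatures -/

/-- `c • s` is a signature of `p`: for some `p = h₁ f₁ + ⋯ + h_j f_j` with `j = s.idx` and
`h_j ≠ 0`, the leading term of `h_j` is `c • s.mon`. -/
def IsSignature (F : Fin (i + 1) → MvPolynomial (Fin n) K) (c : K) (s : MonSig n i)
    (p : MvPolynomial (Fin n) K) : Prop :=
  ∃ h : Fin (i + 1) → MvPolynomial (Fin n) K,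
    p = ∑ k, h k * F k ∧ (∀ k, s.idx < k → h k = 0) ∧ h s.idx ≠ 0 ∧
      m.leadingCoeff (h s.idx) = c ∧ m.degree (h s.idx) = s.mon

/-- `s` is the (monic part of the) minimal signature of `p`. -/
def IsMinSignature (F : Fin (i + 1) → MvPolynomial (Fin n) K) (s : MonSig n i)
    (p : MvPolynomial (Fin n) K) : Prop :=
  (∃ c, IsSignature m F c s p) ∧ ∀ c t, IsSignature m F c t p → s.LE m t

/-- `(c • s, p)` has a standard representation with respect to `G`, a set of polynomials labelled
by their minimal signatures. -/
def HasSigRepresentation (F : Fin (i + 1) → MvPolynomial (Fin n) K) (G : Finset (Labeled K n i))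
    (c : K) (s : MonSig n i) (p : MvPolynomial (Fin n) K) : Prop :=
  IsSignature m F c s p ∧
    ∃ h : Labeled K n i → MvPolynomial (Fin n) K,
      p = ∑ g ∈ G, h g * g.poly ∧
      ∀ g ∈ G, h g = 0 ∨
        (p ≠ 0 ∧ m.degree (h g) + m.degree g.poly ≼[m] m.degree p ∧
          (g.sig.mul (m.degree (h g))).LE m s)

/-- The signature criterion for `G` to yield a Gröbner basis of `⟨f₁, …, f_{i+1}⟩`. The pairs in
`pairs` are oriented so that the first multiplied signature is larger; pairs whose multiplied
signatures are equal are exempt. -/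
structure SignatureCriterion (F : Fin (i + 1) → MvPolynomial (Fin n) K)
    (G : Finset (Labeled K n i)) : Prop where
  ne_zero : ∀ g ∈ G, g.poly ≠ 0
  mem_ideal : ∀ g ∈ G, g.poly ∈ Ideal.span (Set.range F)
  lower : IsGroebnerBasis m {f | ∃ g ∈ G, g.sig.idx ≠ Fin.last i ∧ g.poly = f}
    (Ideal.span (initialGens F))
  last_mem : (⟨⟨0, Fin.last i⟩, F (Fin.last i)⟩ : Labeled K n i) ∈ G
  minimal : ∀ g ∈ G, IsMinSignature m F g.sig g.poly
  pairs : ∀ p ∈ G, ∀ q ∈ G, p.sig.idx = Fin.last i →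
    (q.sig.mul (cofactor m q.poly p.poly)).LT m (p.sig.mul (cofactor m p.poly q.poly)) →
    HasSigRepresentation m F G 1 (p.sig.mul (cofactor m p.poly q.poly)) (spoly m p.poly q.poly)

/-! ### Signature-redundancy and σ-reduction

The basis computed by the algorithm is a list whose head is the most recently added element; all
labels in it are monic. -/

/-- `x` is signature-redundant to `G`. -/
def Redundant (G : List (Labeled K n i)) (x : Labeled K n i) : Prop :=
  x.sig.idx = Fin.last i ∧
    ∃ g ∈ G, g.sig.idx = Fin.last i ∧ g.poly ≠ 0 ∧
      g.sig.mon ≤ x.sig.mon ∧ m.degree g.poly ≤ m.degree x.poly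

/-- The elements of `G` that are nonzero and were not signature-redundant when they were added. -/
def active : List (Labeled K n i) → List (Labeled K n i)
  | [] => []
  | x :: G => if x.poly ≠ 0 ∧ ¬ Redundant m G x then x :: active G else active G

/-- One σ-reduction of type (A): the signature `c • s` of `r` is preserved. -/
def ReducesA (G : List (Labeled K n i)) (s : MonSig n i) (r r' : MvPolynomial (Fin n) K) : Prop :=
  r ≠ 0 ∧ ∃ g ∈ G, ∃ (a : K) (t : Fin n →₀ ℕ),
    monomial t a * m.leadingTerm g.poly = m.leadingTerm r ∧
    (g.sig.mul t).LT m s ∧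
    r' = r - monomial t a * g.poly

/-- One σ-reduction of type (B): the multiplied signature is level with `c • s`, and only the
coefficient of the signature changes, from `c` to `c' ≠ 0`. -/
def ReducesB (G : List (Labeled K n i)) (s : MonSig n i) (c c' : K)
    (r r' : MvPolynomial (Fin n) K) : Prop :=
  r ≠ 0 ∧ ∃ g ∈ G, ∃ (a : K) (t : Fin n →₀ ℕ),
    monomial t a * m.leadingTerm g.poly = m.leadingTerm r ∧
    g.sig.mul t = s ∧ a ≠ c ∧ c' = c - a ∧
    r' = r - monomial t a * g.poly

/-! ### The algorithm -/

/-- The oriented critical pair of the new element `(σ e_{i+1}, r)` with `g`; there is none if the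
multiplied signatures agree. -/
def newPair (σ : Fin n →₀ ℕ) (r : MvPolynomial (Fin n) K) (g : Labeled K n i) :
    Option (CritPair K n) :=
  let s : MonSig n i := MonSig.mul (cofactor m r g.poly) ⟨σ, Fin.last i⟩
  let t : MonSig n i := MonSig.mul (cofactor m g.poly r) g.sig
  if s = t then none
  else if t.LT m s then some ⟨s.mon, r, g.poly⟩
  else some ⟨t.mon, g.poly, r⟩

/-- The critical pairs created for `(σ e_{i+1}, r)`: none if `r` is zero or signature-redundant to
`G`, otherwise those with the active elements of `G`. -/
def newPairs (G : List (Labeled K n i)) (σ : Fin n →₀ ℕ) (r : MvPolynomial (Fin n) K) :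
    Finset (CritPair K n) :=
  if r ≠ 0 ∧ ¬ Redundant m G ⟨⟨σ, Fin.last i⟩, r⟩ then
    ((active m G).filterMap (newPair m σ r)).toFinset
  else ∅

/-- States of the algorithm. In `outer` the outer loop test is next; in `inner`, with current
degree `d`, the inner loop test is next; in `reducing`, the polynomial `r`, of signature
`c • σ e_{i+1}`, is being σ-reduced. -/
inductive State (K : Type*) [Field K] (n i : ℕ) where
  | outer (G : List (Labeled K n i)) (P : Finset (CritPair K n))
  | inner (G : List (Labeled K n i)) (P S : Finset (CritPair K n)) (d : ℕ)
  | reducing (G : List (Labeled K n i)) (P S : Finset (CritPair K n)) (d : ℕ)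
      (σ : Fin n →₀ ℕ) (c : K) (r : MvPolynomial (Fin n) K)

/-- The initial state: the basis consists of the `(e_j, f_j)`, and the pairs are those of `f_{i+1}`
with `f₁, …, f_i`. -/
def initial (F : Fin (i + 1) → MvPolynomial (Fin n) K) : State K n i :=
  .outer (List.ofFn fun j => (⟨⟨0, j⟩, F j⟩ : Labeled K n i)).reverse
    (Finset.univ.image fun j : Fin i =>
      (⟨cofactor m (F (Fin.last i)) (F j.castSucc), F (Fin.last i), F j.castSucc⟩ :
        CritPair K n))

/-- One step of the algorithm (nondeterministic: any pair of minimal signature may be picked, and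
any semi-complete reduction, i.e. one that ends when no reduction of type (A) is possible, may be
performed). -/
inductive Step : State K n i → State K n i → Prop
  /-- Select the pairs of minimal degree. -/
  | select (G : List (Labeled K n i)) (P : Finset (CritPair K n)) (d : ℕ)
      (hd : ∃ x ∈ P, x.mon.degree = d) (hmin : ∀ x ∈ P, d ≤ x.mon.degree) :
      Step (.outer G P)
        (.inner G (P.filter fun x => x.mon.degree ≠ d) (P.filter fun x => x.mon.degree = d) d)
  /-- Pick and remove a pair of minimal signature, and form its S-polynomial. -/
  | pick (G : List (Labeled K n i)) (P S : Finset (CritPair K n)) (d : ℕ) (x : CritPair K n)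
      (hx : x ∈ S) (hmin : ∀ y ∈ S, x.mon ≼[m] y.mon) :
      Step (.inner G P S d) (.reducing G P (S.erase x) d x.mon 1 (spoly m x.left x.right))
  | reduceA (G : List (Labeled K n i)) (P S : Finset (CritPair K n)) (d : ℕ)
      (σ : Fin n →₀ ℕ) (c : K) (r r' : MvPolynomial (Fin n) K)
      (h : ReducesA m G ⟨σ, Fin.last i⟩ r r') :
      Step (.reducing G P S d σ c r) (.reducing G P S d σ c r')
  | reduceB (G : List (Labeled K n i)) (P S : Finset (CritPair K n)) (d : ℕ)
      (σ : Fin n →₀ ℕ) (c c' : K) (r r' : MvPolynomial (Fin n) K)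
      (h : ReducesB m G ⟨σ, Fin.last i⟩ c c' r r') :
      Step (.reducing G P S d σ c r) (.reducing G P S d σ c' r')
  /-- The reduction is semi-complete: normalize the signature, create pairs, append to the basis. -/
  | append (G : List (Labeled K n i)) (P S : Finset (CritPair K n)) (d : ℕ)
      (σ : Fin n →₀ ℕ) (c : K) (r : MvPolynomial (Fin n) K)
      (h : ¬ ∃ r', ReducesA m G ⟨σ, Fin.last i⟩ r r') :
      Step (.reducing G P S d σ c r)
        (.inner (⟨⟨σ, Fin.last i⟩, C c⁻¹ * r⟩ :: G)
          (P ∪ (newPairs m G σ (C c⁻¹ * r)).filter fun x => x.mon.degree ≠ d)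
          (S ∪ (newPairs m G σ (C c⁻¹ * r)).filter fun x => x.mon.degree = d) d)
  /-- Leave the inner loop. -/
  | leave (G : List (Labeled K n i)) (P : Finset (CritPair K n)) (d : ℕ) :
      Step (.inner G P ∅ d) (.outer G P)

/-- `s` occurs in some run of the algorithm on input `F`. -/
def Reachable (F : Fin (i + 1) → MvPolynomial (Fin n) K) (s : State K n i) : Prop :=
  Relation.ReflTransGen (Step m) (initial m F) s

/-- What the algorithm returns when it stops with the basis `G`. -/
def output (G : List (Labeled K n i)) : Finset (Labeled K n i) :=
  (active m G).toFinset

end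

end

end SigGB

namespace SigGB

open MvPolynomial
open scoped Classical

section

variable {K : Type*} [Field K] {n i : ℕ} {m : MonomialOrder (Fin n)}

/-! ### Cancellation of leading terms -/

/-! Termination. To each nonzero element of the basis with signature `σ e_{i+1}` and leading
monomial `μ`, attach the point `(σ, μ)`. New critical pairs arise only when this point lies outside
the upper set generated by the earlier ones, and by Dickson's lemma such an upper set cannot grow
forever. Between two growths, a count of pending pairs decreases, and within one reduction the
leading monomial decreases.

Correctness. Modulo `I_i`, an element of `I_{i+1}` is a multiple `h f_{i+1}`. `TopCoeff` records a
bound `σ` on `h` and the coefficient of `h` at `σ`. This coefficient is additive, and when it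
vanishes the element lies in `I_i` or has a smaller signature. Hence two elements of signature `σ`
can be combined to descend.

The core is `topReducible_le`: once the critical pairs up to `σ` are processed, every nonzero
element of signature at most `σ` is top-reducible by an active element without exceeding `σ`. Among
the multiples of active elements with signature `σ`, take `t g` with least leading monomial. If `t
g` were reducible below `σ`, a processed critical pair would give either a smaller such multiple,
contrary to the choice, or a syzygy of signature `σ`, which permits descent. Otherwise `p - c t g`
has a smaller signature or lies in `I_i`, and its reducer, if not `g` itself, serves for `p`.

The run maintains the hypotheses of this statement: degree compatibility and the choice of a minimal
pair ensure that all pairs below the current signature are processed. A type (A) irreducible result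
then has minimal signature, and dropping redundant elements is harmless (`BasisInvariant.append`).
At the end all pairs are processed, so top reductions always exist; iterating them yields the
standard representations and the Gröbner basis property. -/

theorem sub_eq_zero_or_degree_lt {p q : MvPolynomial (Fin n) K}
    (h : m.leadingTerm q = m.leadingTerm p) :
    p - q = 0 ∨ m.degree (p - q) ≺[m] m.degree p := by
  by_cases h0 : p - q = 0
  · exact .inl h0
  obtain ⟨hc, hd⟩ := m.leadingTerm_eq_leadingTerm_iff.mp h
  refine .inr (lt_of_le_of_ne ?_ fun he => ?_)
  · simpa [hd] using m.degree_sub_le (f := p) (g := q)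
  · apply m.coeff_degree_ne_zero_iff.mpr h0
    rw [m.toSyn.injective he, coeff_sub, sub_eq_zero]
    simpa [MonomialOrder.leadingCoeff, hd] using hc.symm

theorem degree_monomial_mul {a : K} (ha : a ≠ 0) (t : Fin n →₀ ℕ) {p : MvPolynomial (Fin n) K}
    (hp : p ≠ 0) : m.degree (monomial t a * p) = t + m.degree p := by
  rw [m.degree_mul (by simpa using ha) hp, m.degree_monomial, if_neg ha]

theorem monomial_mul_leadingTerm (a : K) (t : Fin n →₀ ℕ) (p : MvPolynomial (Fin n) K) :
    monomial t a * m.leadingTerm p = m.leadingTerm (monomial t a * p) := by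
  rw [m.leadingTerm_mul, m.leadingTerm_monomial]

theorem leadingTerm_monomial_mul (a : K) (t : Fin n →₀ ℕ) (p : MvPolynomial (Fin n) K) :
    m.leadingTerm (monomial t a * p) = monomial (t + m.degree p) (a * m.leadingCoeff p) := by
  rw [← monomial_mul_leadingTerm, MonomialOrder.leadingTerm, monomial_mul]

theorem cofactor_add_degree (p q : MvPolynomial (Fin n) K) :
    cofactor m p q + m.degree p = lcmLM m p q :=
  tsub_add_cancel_of_le le_sup_left

theorem lcmLM_comm (p q : MvPolynomial (Fin n) K) : lcmLM m p q = lcmLM m q p :=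
  sup_comm _ _

theorem spoly_eq_zero_or_degree_lt {p q : MvPolynomial (Fin n) K} (hp : p ≠ 0) (hq : q ≠ 0) :
    spoly m p q = 0 ∨ m.degree (spoly m p q) ≺[m] lcmLM m p q := by
  have h := sub_eq_zero_or_degree_lt (m := m) (p := monomial (cofactor m p q) 1 * p)
    (q := monomial (cofactor m q p) (m.leadingCoeff p / m.leadingCoeff q) * q) (by
      rw [leadingTerm_monomial_mul, leadingTerm_monomial_mul, cofactor_add_degree,
        cofactor_add_degree, lcmLM_comm, one_mul,
        div_mul_cancel₀ _ (m.leadingCoeff_ne_zero_iff.mpr hq)])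
  rwa [degree_monomial_mul one_ne_zero _ hp, cofactor_add_degree] at h

/-! ### The order on monic signatures -/

theorem MonSig.lt_last_iff {s : MonSig n i} (hs : s.idx = Fin.last i) {σ : Fin n →₀ ℕ} :
    s.LT m ⟨σ, Fin.last i⟩ ↔ s.mon ≺[m] σ := by
  simp [MonSig.LT, hs]

theorem MonSig.lt_irrefl (s : MonSig n i) : ¬ s.LT m s := by
  simp [MonSig.LT]

theorem MonSig.not_lt_of_lt {s t : MonSig n i} (h : s.LT m t) : ¬ t.LT m s := by
  rintro (h' | ⟨h₁, h₂⟩) <;> rcases h with h | ⟨h₃, h₄⟩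
  · exact absurd h h'.not_gt
  · exact absurd h' (h₃ ▸ _root_.lt_irrefl _)
  · exact absurd h (h₁ ▸ _root_.lt_irrefl _)
  · exact absurd h₂ h₄.not_gt

theorem MonSig.lt_trichotomy (s t : MonSig n i) : s.LT m t ∨ s = t ∨ t.LT m s := by
  obtain ⟨a, j⟩ := s
  obtain ⟨b, k⟩ := t
  rcases _root_.lt_trichotomy j k with h | rfl | h
  · exact .inl (.inl h)
  · rcases _root_.lt_trichotomy (m.toSyn a) (m.toSyn b) with h | h | h
    · exact .inl (.inr ⟨rfl, h⟩)
    · exact .inr (.inl (by rw [m.toSyn.injective h]))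
    · exact .inr (.inr (.inr ⟨rfl, h⟩))
  · exact .inr (.inr (.inl h))

/-! ### Signatures at the last position -/

/-- Modulo the first `i` generators, `p` is a multiple `h * f` of the last one, with `h` of degree
at most `σ` and with coefficient `c`, possibly zero, at `σ`. -/
def TopCoeff (m : MonomialOrder (Fin n)) (F : Fin (i + 1) → MvPolynomial (Fin n) K)
    (σ : Fin n →₀ ℕ) (c : K) (p : MvPolynomial (Fin n) K) : Prop :=
  ∃ h : MvPolynomial (Fin n) K, m.degree h ≼[m] σ ∧ h.coeff σ = c ∧
    p - h * F (Fin.last i) ∈ Ideal.span (initialGens F)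

section Position

variable {F : Fin (i + 1) → MvPolynomial (Fin n) K}

theorem TopCoeff.sub {σ : Fin n →₀ ℕ} {c d : K} {p q : MvPolynomial (Fin n) K}
    (hp : TopCoeff m F σ c p) (hq : TopCoeff m F σ d q) : TopCoeff m F σ (c - d) (p - q) := by
  obtain ⟨h, hd, rfl, hm⟩ := hp
  obtain ⟨h', hd', rfl, hm'⟩ := hq
  refine ⟨h - h', m.degree_sub_le.trans (max_le hd hd'), by simp, ?_⟩
  convert Ideal.sub_mem _ hm hm' using 1
  ring

theorem TopCoeff.monomial_mul {σ : Fin n →₀ ℕ} {c : K} {p : MvPolynomial (Fin n) K}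
    (hp : TopCoeff m F σ c p) (t : Fin n →₀ ℕ) (a : K) :
    TopCoeff m F (t + σ) (a * c) (monomial t a * p) := by
  obtain ⟨h, hd, rfl, hm⟩ := hp
  refine ⟨monomial t a * h, ?_, coeff_monomial_mul _ _ _ _, ?_⟩
  · refine m.degree_mul_le.trans ?_
    rw [map_add, map_add]
    exact add_le_add (m.degree_monomial_le a) hd
  · convert Ideal.mul_mem_left _ (monomial t a) hm using 1
    ring

theorem TopCoeff.of_mem {p : MvPolynomial (Fin n) K} (hp : p ∈ Ideal.span (initialGens F))
    (σ : Fin n →₀ ℕ) : TopCoeff m F σ 0 p :=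
  ⟨0, by simp, by simp, by simpa using hp⟩

theorem TopCoeff.of_lt {σ τ : Fin n →₀ ℕ} {c : K} {p : MvPolynomial (Fin n) K}
    (hp : TopCoeff m F τ c p) (h : τ ≺[m] σ) : TopCoeff m F σ 0 p := by
  obtain ⟨h', hd, -, hm⟩ := hp
  exact ⟨h', hd.trans h.le, m.coeff_eq_zero_of_lt (hd.trans_lt h), hm⟩

/-- With no term at `σ`, the multiplier `h` is zero or has its leading monomial below `σ`. This is
the descent behind every induction on signatures. -/
theorem TopCoeff.mem_or_exists_lt {σ : Fin n →₀ ℕ} {p : MvPolynomial (Fin n) K}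
    (hp : TopCoeff m F σ 0 p) :
    p ∈ Ideal.span (initialGens F) ∨ ∃ τ c, τ ≺[m] σ ∧ TopCoeff m F τ c p := by
  obtain ⟨h, hd, hc, hm⟩ := hp
  by_cases h0 : h = 0
  · exact .inl (by simpa [h0] using hm)
  refine .inr ⟨m.degree h, h.coeff (m.degree h), lt_of_le_of_ne hd fun he => ?_,
    h, le_rfl, rfl, hm⟩
  rw [← m.toSyn.injective he] at hc
  exact m.coeff_degree_ne_zero_iff.mpr h0 hc

theorem sum_castSucc_mem (h : Fin (i + 1) → MvPolynomial (Fin n) K) :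
    ∑ k : Fin i, h k.castSucc * F k.castSucc ∈ Ideal.span (initialGens F) :=
  Ideal.sum_mem _ fun k _ => Ideal.mul_mem_left _ _ (Ideal.subset_span ⟨k, rfl⟩)

theorem exists_topCoeff {p : MvPolynomial (Fin n) K} (hp : p ∈ Ideal.span (Set.range F)) :
    ∃ σ c, TopCoeff m F σ c p := by
  obtain ⟨h, rfl⟩ := Ideal.mem_span_range_iff_exists_fun.mp hp
  refine ⟨_, _, h (Fin.last i), le_rfl, rfl, ?_⟩
  rw [Fin.sum_univ_castSucc, add_sub_cancel_right]
  exact sum_castSucc_mem h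

/-- The multipliers of the first `i` generators are unconstrained, so only the class of `p` modulo
their ideal matters; a nonzero coefficient at the bound `σ` forces the leading monomial of `h` to be
`σ`. -/
theorem isSignature_last_iff {σ : Fin n →₀ ℕ} {c : K} {p : MvPolynomial (Fin n) K} :
    IsSignature m F c ⟨σ, Fin.last i⟩ p ↔ c ≠ 0 ∧ TopCoeff m F σ c p := by
  constructor
  · rintro ⟨h, rfl, -, h0, rfl, hd⟩
    dsimp only at *
    refine ⟨m.leadingCoeff_ne_zero_iff.mpr h0, h (Fin.last i), hd ▸ le_rfl, by rw [← hd]; rfl, ?_⟩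
    rw [Fin.sum_univ_castSucc, add_sub_cancel_right]
    exact sum_castSucc_mem h
  · rintro ⟨hc, h, hd, rfl, hm⟩
    obtain ⟨a, ha⟩ := Ideal.mem_span_range_iff_exists_fun.mp hm
    have hdeg : m.degree h = σ :=
      m.toSyn.injective (le_antisymm hd (m.le_degree (mem_support_iff.mpr hc)))
    refine ⟨Fin.snoc (α := fun _ => MvPolynomial (Fin n) K) a h, ?_, ?_, ?_, ?_, ?_⟩
    · rw [Fin.sum_univ_castSucc]
      simp only [Fin.snoc_castSucc, Fin.snoc_last, ha]
      ring
    · intro k hk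
      exact absurd hk (Fin.le_last k).not_gt
    · rintro h0
      simp only [Fin.snoc_last] at h0
      simp [h0] at hc
    · simp [MonomialOrder.leadingCoeff, hdeg]
    · simpa using hdeg

theorem IsSignature.topCoeff {s : MonSig n i} (hs : s.idx = Fin.last i) {c : K}
    {p : MvPolynomial (Fin n) K} (h : IsSignature m F c s p) : TopCoeff m F s.mon c p := by
  obtain ⟨σ, j⟩ := s
  obtain rfl : j = Fin.last i := hs
  exact (isSignature_last_iff.mp h).2

theorem IsSignature.mem_of_ne_last {s : MonSig n i} (hs : s.idx ≠ Fin.last i) {c : K}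
    {p : MvPolynomial (Fin n) K} (h : IsSignature m F c s p) :
    p ∈ Ideal.span (initialGens F) := by
  obtain ⟨h, rfl, hz, -⟩ := h
  rw [Fin.sum_univ_castSucc, hz _ (lt_of_le_of_ne (Fin.le_last _) hs), zero_mul, add_zero]
  exact sum_castSucc_mem h

theorem IsSignature.mem_span {s : MonSig n i} {c : K} {p : MvPolynomial (Fin n) K}
    (h : IsSignature m F c s p) : p ∈ Ideal.span (Set.range F) := by
  obtain ⟨h, rfl, -⟩ := h
  exact Ideal.sum_mem _ fun k _ => Ideal.mul_mem_left _ _ (Ideal.subset_span ⟨k, rfl⟩)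

theorem IsSignature.topCoeff_monomial_mul_of_lt {s : MonSig n i} {c : K}
    {p : MvPolynomial (Fin n) K} (h : IsSignature m F c s p) {t σ : Fin n →₀ ℕ}
    (hlt : (s.mul t).LT m ⟨σ, Fin.last i⟩) (a : K) :
    TopCoeff m F σ 0 (monomial t a * p) := by
  by_cases hs : s.idx = Fin.last i
  · exact ((h.topCoeff hs).monomial_mul t a).of_lt
      ((MonSig.lt_last_iff (s := s.mul t) hs).mp hlt)
  · exact .of_mem (Ideal.mul_mem_left _ _ (h.mem_of_ne_last hs)) σ

theorem IsSignature.topCoeff_of_lt {s : MonSig n i} {c : K}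
    {p : MvPolynomial (Fin n) K} (h : IsSignature m F c s p) {σ : Fin n →₀ ℕ}
    (hlt : s.LT m ⟨σ, Fin.last i⟩) : TopCoeff m F σ 0 p := by
  simpa using h.topCoeff_monomial_mul_of_lt (t := 0) (by simpa [MonSig.mul] using hlt) 1

theorem IsSignature.topCoeff_monomial_mul_of_eq {s : MonSig n i} {c : K}
    {p : MvPolynomial (Fin n) K} (h : IsSignature m F c s p) {t σ : Fin n →₀ ℕ}
    (he : s.mul t = ⟨σ, Fin.last i⟩) (a : K) :
    TopCoeff m F σ (a * c) (monomial t a * p) := by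
  obtain ⟨τ, j⟩ := s
  simp only [MonSig.mul, MonSig.mk.injEq] at he
  obtain ⟨rfl, rfl⟩ := he
  exact (h.topCoeff rfl).monomial_mul t a

/-- A signature at an earlier position would put `F j` into the ideal of its predecessors, and at
position `j` no monomial is smaller than 1. -/
theorem isMinSignature_generator (hF : ∀ j, F j ∉ Ideal.span (F '' {k | k < j}))
    (j : Fin (i + 1)) : IsSignature m F 1 ⟨0, j⟩ (F j) ∧ IsMinSignature m F ⟨0, j⟩ (F j) := by
  have hs : IsSignature m F 1 ⟨0, j⟩ (F j) := by
    refine ⟨Pi.single j 1, ?_, fun k hk => ?_, ?_, ?_, ?_⟩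
    · simp [Pi.single_apply]
    · simp [(show j < k from hk).ne']
    all_goals simp
  refine ⟨hs, ⟨1, hs⟩, ?_⟩
  rintro c ⟨τ, k⟩ ⟨h, hp, hz, -⟩
  rcases lt_trichotomy j k with hjk | rfl | hkj
  · exact .inr (.inl hjk)
  · by_cases hτ : τ = 0
    · exact .inl (by rw [hτ])
    · refine .inr (.inr ⟨rfl, ?_⟩)
      simpa [MonomialOrder.toSyn_lt_iff_ne_zero] using hτ
  · refine absurd ?_ (hF j)
    rw [hp]
    refine Ideal.sum_mem _ fun l _ => ?_
    rcases lt_or_ge k l with hl | hl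
    · simp [hz l hl]
    · exact Ideal.mul_mem_left _ _ (Ideal.subset_span ⟨l, lt_of_le_of_lt hl hkj, rfl⟩)

end Position

/-! ### Termination and progress -/

/-- `withBotDegree` separates zero from the nonzero constants, which share `degree` zero, so
cancellation to zero also counts as a decrease. -/
theorem withBotDegree_sub_lt {p q : MvPolynomial (Fin n) K} (hp : p ≠ 0)
    (h : m.leadingTerm q = m.leadingTerm p) :
    m.toWithBotSyn (m.withBotDegree (p - q)) < m.toWithBotSyn (m.withBotDegree p) := by
  rw [m.withBotDegree_lt_withBotDegree_iff]
  rcases sub_eq_zero_or_degree_lt h with h0 | h0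
  · simp [h0, hp]
  · simp [h0, hp]

/-- From a strictly growing chain pick a point new at each stage. Two of these points are comparable
in the order of their stages, so the later one already lay in the upper set when it was supposed to
be new. -/
theorem wellFounded_isUpperSet_gt {α : Type*} [Preorder α] [WellQuasiOrderedLE α] :
    WellFounded fun s t : {s : Set α // IsUpperSet s} => t.1 ⊂ s.1 := by
  refine wellFounded_iff_isEmpty_descending_chain.mpr ⟨fun ⟨f, hf⟩ => ?_⟩
  choose x hx hx' using fun k => Set.exists_of_ssubset (hf k)
  obtain ⟨k, l, hkl, hle⟩ := wellQuasiOrdered_le x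
  have hmono : Monotone fun k => (f k : Set α) := monotone_nat_of_le_succ fun k => (hf k).subset
  exact hx' l ((f l).2 hle (hmono hkl (hx k)))

/-- The pairs (signature monomial, exponent of a monomial) of multiples of the nonzero elements of
`G` with signature at the last position. -/
def multiples (m : MonomialOrder (Fin n)) (G : List (Labeled K n i)) :
    {s : Set ((Fin n →₀ ℕ) × (Fin n →₀ ℕ)) // IsUpperSet s} :=
  ⟨{x | ∃ g ∈ G, g.sig.idx = Fin.last i ∧ g.poly ≠ 0 ∧
      g.sig.mon ≤ x.1 ∧ m.degree g.poly ≤ x.2},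
    fun _ _ hxy ⟨g, hg, hi, h0, h₁, h₂⟩ => ⟨g, hg, hi, h0, h₁.trans hxy.1, h₂.trans hxy.2⟩⟩

theorem multiples_subset_cons (x : Labeled K n i) (G : List (Labeled K n i)) :
    (multiples m G).1 ⊆ (multiples m (x :: G)).1 :=
  fun _ ⟨g, hg, h⟩ => ⟨g, List.mem_cons_of_mem _ hg, h⟩

theorem multiples_ssubset_cons {G : List (Labeled K n i)} {σ : Fin n →₀ ℕ}
    {r : MvPolynomial (Fin n) K} (h : (newPairs m G σ r).Nonempty) :
    (multiples m G).1 ⊂ (multiples m (⟨⟨σ, Fin.last i⟩, r⟩ :: G)).1 := by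
  have h' : r ≠ 0 ∧ ¬ Redundant m G ⟨⟨σ, Fin.last i⟩, r⟩ := by
    by_contra hc
    simp [newPairs, if_neg hc] at h
  refine ⟨multiples_subset_cons _ _, fun hsub => h'.2 ⟨rfl, ?_⟩⟩
  exact @hsub (σ, m.degree r) ⟨_, List.mem_cons_self, rfl, h'.1, le_rfl, le_rfl⟩

namespace State

def basis : State K n i → List (Labeled K n i)
  | outer G _ => G
  | inner G _ _ _ => G
  | reducing G _ _ _ _ _ _ => G

/-- A weight that every step decreases, apart from single reductions and from the creation of
critical pairs. -/
noncomputable def weight : State K n i → ℕ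
  | outer _ P => 4 * P.card + 1
  | inner _ P S _ => 4 * (P.card + S.card) + if S = ∅ then 2 else 0
  | reducing _ P S _ _ _ _ => 4 * (P.card + S.card) + 3

noncomputable def current : State K n i → MvPolynomial (Fin n) K
  | outer _ _ => 0
  | inner _ _ _ _ => 0
  | reducing _ _ _ _ _ _ r => r

/-- The termination measure. -/
noncomputable def measure (m : MonomialOrder (Fin n)) (s : State K n i) :
    {s : Set ((Fin n →₀ ℕ) × (Fin n →₀ ℕ)) // IsUpperSet s} × ℕ × WithBot m.syn :=
  (multiples m s.basis, s.weight, m.toWithBotSyn (m.withBotDegree s.current))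

end State

theorem Step.measure_lt {s t : State K n i} (h : Step m s t) :
    Prod.Lex (fun a b => b.1 ⊂ a.1) (Prod.Lex (· < ·) (· < ·))
      (t.measure m) (s.measure m) := by
  -- With `k` pending pairs the weight goes from `4k + 1` to `4k` at `select`, from `4k` to `4(k -
  -- 1) + 3` at `pick`, from `4k + 3` to at most `4k + 2` at an `append` without new pairs, and from
  -- `4k + 2` to `4k + 1` at `leave`.
  cases h with
  | select G P d hd hmin =>
    refine .right _ (.left _ _ ?_)
    obtain ⟨x, hx, hxd⟩ := hd
    have hne : (P.filter fun x => x.mon.degree = d) ≠ ∅ :=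
      Finset.ne_empty_of_mem (Finset.mem_filter.mpr ⟨hx, hxd⟩)
    have := Finset.card_filter_add_card_filter_not (s := P) fun x => x.mon.degree = d
    simp only [State.weight, if_neg hne]
    simp only [ne_eq] at this ⊢
    omega
  | pick G P S d x hx hmin =>
    refine .right _ (.left _ _ ?_)
    have := Finset.card_erase_add_one hx
    simp only [State.weight]
    omega
  | reduceA G P S d σ c r r' h =>
    obtain ⟨h0, g, hg, a, t, ht, -, rfl⟩ := h
    exact .right _ (.right _ (withBotDegree_sub_lt h0 (monomial_mul_leadingTerm a t _ ▸ ht)))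
  | reduceB G P S d σ c c' r r' h =>
    obtain ⟨h0, g, hg, a, t, ht, -, -, -, rfl⟩ := h
    exact .right _ (.right _ (withBotDegree_sub_lt h0 (monomial_mul_leadingTerm a t _ ▸ ht)))
  | append G P S d σ c r h =>
    by_cases hn : (newPairs m G σ (C c⁻¹ * r)).Nonempty
    · exact .left _ _ (multiples_ssubset_cons hn)
    rw [Finset.not_nonempty_iff_eq_empty] at hn
    rw [hn]
    simp only [Finset.filter_empty, Finset.union_empty]
    -- Without new pairs the set of multiples may still grow; if it does not, the weight decides.
    rcases (multiples_subset_cons (m := m) ⟨⟨σ, Fin.last i⟩, C c⁻¹ * r⟩ G).eq_or_ssubset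
      with he | hlt
    · have he' := Subtype.ext he
      simp only [State.measure, State.basis, ← he']
      refine .right _ (.left _ _ ?_)
      simp only [State.weight]
      split_ifs <;> omega
    · exact .left _ _ hlt
  | leave G P d =>
    refine .right _ (.left _ _ ?_)
    simp [State.weight]

theorem not_exists_infinite_run :
    ¬ ∃ run : ℕ → State K n i, ∀ k, Step m (run k) (run (k + 1)) := by
  rintro ⟨run, h⟩
  have wf := (wellFounded_isUpperSet_gt (α := (Fin n →₀ ℕ) × (Fin n →₀ ℕ))).prod_lex
    ((wellFounded_lt (α := ℕ)).prod_lex (wellFounded_lt (α := WithBot m.syn)))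
  exact (wellFounded_iff_isEmpty_descending_chain.mp wf).false
    ⟨fun k => (run k).measure m, fun k => (h k).measure_lt⟩

theorem exists_step_or_eq_outer (s : State K n i) :
    (∃ t, Step m s t) ∨ ∃ G, s = .outer G ∅ := by
  cases s with
  | outer G P =>
    rcases P.eq_empty_or_nonempty with rfl | hP
    · exact .inr ⟨G, rfl⟩
    · obtain ⟨x, hx, hmin⟩ := P.exists_min_image (fun x => x.mon.degree) hP
      exact .inl ⟨_, .select G P _ ⟨x, hx, rfl⟩ hmin⟩
  | inner G P S d =>
    rcases S.eq_empty_or_nonempty with rfl | hS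
    · exact .inl ⟨_, .leave G P d⟩
    · obtain ⟨x, hx, hmin⟩ := S.exists_min_image (fun x => m.toSyn x.mon) hS
      exact .inl ⟨_, .pick G P S d x hx hmin⟩
  | reducing G P S d σ c r =>
    by_cases h : ∃ r', ReducesA m G ⟨σ, Fin.last i⟩ r r'
    · obtain ⟨r', h⟩ := h
      exact .inl ⟨_, .reduceA G P S d σ c r r' h⟩
    · exact .inl ⟨_, .append G P S d σ c r h⟩

variable {F : Fin (i + 1) → MvPolynomial (Fin n) K} {G : List (Labeled K n i)}

/-! ### Active elements and critical pairs -/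

theorem mem_of_mem_active {g : Labeled K n i} (h : g ∈ active m G) : g ∈ G := by
  induction G with
  | nil => simp [active] at h
  | cons x G ih =>
    rw [active] at h
    split_ifs at h
    · rcases List.mem_cons.mp h with rfl | h
      · exact List.mem_cons_self
      · exact List.mem_cons_of_mem _ (ih h)
    · exact List.mem_cons_of_mem _ (ih h)

theorem ne_zero_of_mem_active {g : Labeled K n i} (h : g ∈ active m G) : g.poly ≠ 0 := by
  induction G with
  | nil => simp [active] at h
  | cons x G ih =>
    rw [active] at h
    split_ifs at h with hx
    · rcases List.mem_cons.mp h with rfl | h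
      · exact hx.1
      · exact ih h
    · exact ih h

theorem mem_active_cons {x g : Labeled K n i} :
    g ∈ active m (x :: G) ↔
      (g = x ∧ x.poly ≠ 0 ∧ ¬ Redundant m G x) ∨ g ∈ active m G := by
  rw [active]
  split_ifs with h <;> simp [h]

theorem active_eq_self (h : ∀ g ∈ G, g.poly ≠ 0 ∧ g.sig.idx ≠ Fin.last i) :
    active m G = G := by
  induction G with
  | nil => rfl
  | cons x G ih =>
    have hx := h x List.mem_cons_self
    rw [active, if_pos ⟨hx.1, fun hr => hx.2 hr.1⟩, ih fun g hg => h g (List.mem_cons_of_mem _ hg)]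

/-- `x` is the critical pair of `p` and `q`, where the multiplied signature of `p` is larger. -/
def IsOrientedPair (m : MonomialOrder (Fin n)) (p q : Labeled K n i) (x : CritPair K n) : Prop :=
  p.sig.idx = Fin.last i ∧
    (q.sig.mul (cofactor m q.poly p.poly)).LT m (p.sig.mul (cofactor m p.poly q.poly)) ∧
    x = ⟨cofactor m p.poly q.poly + p.sig.mon, p.poly, q.poly⟩

/-- `x` is the critical pair of two active elements of `G`. -/
def IsCritPair (m : MonomialOrder (Fin n)) (G : List (Labeled K n i)) (x : CritPair K n) : Prop :=
  ∃ p ∈ active m G, ∃ q ∈ active m G, IsOrientedPair m p q x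

/-- `G` contains an element with the signature of `x` and with leading monomial below the least
common multiple of the pair. -/
def Processed (m : MonomialOrder (Fin n)) (G : List (Labeled K n i)) (x : CritPair K n) : Prop :=
  ∃ r, ⟨⟨x.mon, Fin.last i⟩, r⟩ ∈ G ∧ (r = 0 ∨ m.degree r ≺[m] lcmLM m x.left x.right)

theorem IsCritPair.cons {x : CritPair K n} (h : IsCritPair m G x) (y : Labeled K n i) :
    IsCritPair m (y :: G) x := by
  obtain ⟨p, hp, q, hq, h⟩ := h
  exact ⟨p, mem_active_cons.mpr (.inr hp), q, mem_active_cons.mpr (.inr hq), h⟩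

theorem Processed.cons {x : CritPair K n} (h : Processed m G x) (y : Labeled K n i) :
    Processed m (y :: G) x := by
  obtain ⟨r, hr, h⟩ := h
  exact ⟨r, List.mem_cons_of_mem _ hr, h⟩

theorem newPair_eq_some_iff {σ : Fin n →₀ ℕ} {r : MvPolynomial (Fin n) K} {g : Labeled K n i}
    {x : CritPair K n} :
    newPair m σ r g = some x ↔
      IsOrientedPair m ⟨⟨σ, Fin.last i⟩, r⟩ g x ∨ IsOrientedPair m g ⟨⟨σ, Fin.last i⟩, r⟩ x := by
  simp only [newPair, IsOrientedPair]
  generalize hs : MonSig.mul (cofactor m r g.poly) ⟨σ, Fin.last i⟩ = s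
  generalize ht : MonSig.mul (cofactor m g.poly r) g.sig = t
  rcases MonSig.lt_trichotomy (m := m) s t with h | h | h
  · have hne : s ≠ t := by
      rintro rfl
      exact MonSig.lt_irrefl _ h
    have hi : g.sig.idx = Fin.last i := by
      subst hs ht
      rcases h with h | ⟨h, -⟩
      · exact absurd h (Fin.le_last _).not_gt
      · exact h.symm
    have hmon : t.mon = cofactor m g.poly r + g.sig.mon := by rw [← ht]; rfl
    simp [hne, MonSig.not_lt_of_lt h, h, hi, hmon, eq_comm]
  · subst h
    simp [MonSig.lt_irrefl]
  · have hne : s ≠ t := by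
      rintro rfl
      exact MonSig.lt_irrefl _ h
    have hmon : s.mon = cofactor m r g.poly + σ := by rw [← hs]; rfl
    simp [hne, MonSig.not_lt_of_lt h, h, hmon, eq_comm]

theorem mem_newPairs {σ : Fin n →₀ ℕ} {r : MvPolynomial (Fin n) K} {x : CritPair K n} :
    x ∈ newPairs m G σ r ↔ (r ≠ 0 ∧ ¬ Redundant m G ⟨⟨σ, Fin.last i⟩, r⟩) ∧
      ∃ g ∈ active m G, IsOrientedPair m ⟨⟨σ, Fin.last i⟩, r⟩ g x ∨
        IsOrientedPair m g ⟨⟨σ, Fin.last i⟩, r⟩ x := by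
  rw [newPairs]
  split_ifs with h
  · simp [newPair_eq_some_iff, h]
  · simp [h]

theorem isCritPair_cons_iff {σ : Fin n →₀ ℕ} {r : MvPolynomial (Fin n) K} {x : CritPair K n} :
    IsCritPair m (⟨⟨σ, Fin.last i⟩, r⟩ :: G) x ↔ IsCritPair m G x ∨ x ∈ newPairs m G σ r := by
  constructor
  · rintro ⟨p, hp, q, hq, h⟩
    rw [mem_active_cons] at hp hq
    rcases hp with ⟨rfl, hp⟩ | hp <;> rcases hq with ⟨rfl, hq⟩ | hq
    · exact absurd h.2.1 (MonSig.lt_irrefl _)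
    · exact .inr (mem_newPairs.mpr ⟨hp, q, hq, .inl h⟩)
    · exact .inr (mem_newPairs.mpr ⟨hq, p, hp, .inr h⟩)
    · exact .inl ⟨p, hp, q, hq, h⟩
  · rintro (h | h)
    · exact h.cons _
    · obtain ⟨hr, g, hg, h | h⟩ := mem_newPairs.mp h
      · exact ⟨_, mem_active_cons.mpr (.inl ⟨rfl, hr⟩), g, mem_active_cons.mpr (.inr hg), h⟩
      · exact ⟨g, mem_active_cons.mpr (.inr hg), _, mem_active_cons.mpr (.inl ⟨rfl, hr⟩), h⟩

/-- The signature of a pair is the larger of two multiplied signatures, one of which is a multiple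
of `σ`. Hence no new pair falls below the current degree. -/
theorem le_of_mem_newPairs {σ : Fin n →₀ ℕ} {r : MvPolynomial (Fin n) K} {x : CritPair K n}
    (hx : x ∈ newPairs m G σ r) : σ ≼[m] x.mon := by
  obtain ⟨-, g, -, ⟨-, -, rfl⟩ | ⟨hi, h, rfl⟩⟩ := mem_newPairs.mp hx
  · exact m.toSyn_monotone le_add_self
  · rcases h with h | ⟨-, h⟩
    · exact absurd (show Fin.last i < g.sig.idx from h) (by simp [hi])
    · exact (m.toSyn_monotone le_add_self).trans h.le

/-- The multiple of `q` lies strictly below the signature of the pair and contributes coefficient 0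
there, so the coefficient 1 of `p` survives. -/
theorem IsOrientedPair.isSignature {p q : Labeled K n i} {x : CritPair K n}
    (h : IsOrientedPair m p q x) (hp : IsSignature m F 1 p.sig p.poly)
    (hq : IsSignature m F 1 q.sig q.poly) :
    IsSignature m F 1 ⟨x.mon, Fin.last i⟩ (spoly m x.left x.right) := by
  obtain ⟨hi, hlt, rfl⟩ := h
  have he : p.sig.mul (cofactor m p.poly q.poly) =
      ⟨cofactor m p.poly q.poly + p.sig.mon, Fin.last i⟩ := by rw [MonSig.mul, hi]
  refine isSignature_last_iff.mpr ⟨one_ne_zero, ?_⟩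
  have h := (hp.topCoeff_monomial_mul_of_eq he 1).sub
    (hq.topCoeff_monomial_mul_of_lt (he ▸ hlt) (m.leadingCoeff p.poly / m.leadingCoeff q.poly))
  rwa [mul_one, sub_zero] at h

/-! ### Reducibility -/

theorem exists_reducesA {g : Labeled K n i} (hg : g ∈ G) (h0 : g.poly ≠ 0) {s : MonSig n i}
    {r : MvPolynomial (Fin n) K} (hr : r ≠ 0) {t : Fin n →₀ ℕ}
    (ht : t + m.degree g.poly = m.degree r) (hlt : (g.sig.mul t).LT m s) :
    ∃ r', ReducesA m G s r r' := by
  refine ⟨_, hr, g, hg, m.leadingCoeff r / m.leadingCoeff g.poly, t, ?_, hlt, rfl⟩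
  rw [monomial_mul_leadingTerm, leadingTerm_monomial_mul, ht,
    div_mul_cancel₀ _ (m.leadingCoeff_ne_zero_iff.mpr h0), MonomialOrder.leadingTerm]

/-- The properties of the list `G` that the algorithm maintains. -/
structure BasisInvariant (m : MonomialOrder (Fin n)) (F : Fin (i + 1) → MvPolynomial (Fin n) K)
    (G : List (Labeled K n i)) : Prop where
  isSignature : ∀ g ∈ G, IsSignature m F 1 g.sig g.poly
  generator_mem : ∀ j, ⟨⟨0, j⟩, F j⟩ ∈ active m G
  -- This makes it harmless to form no pairs with redundant elements: some multiple of an active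
  -- element has the same signature and no larger leading monomial.
  dominated : ∀ g ∈ G, g.sig.idx = Fin.last i → g.poly ≠ 0 →
    ∃ a ∈ active m G, a.sig.idx = Fin.last i ∧
      ∃ w, w + a.sig.mon = g.sig.mon ∧ w + m.degree a.poly ≼[m] m.degree g.poly
  minimal : ∀ g ∈ active m G, IsMinSignature m F g.sig g.poly

/-- `p` is top-reducible by an active element whose multiplied signature satisfies `Q`. -/
def TopReducible (m : MonomialOrder (Fin n)) (G : List (Labeled K n i)) (Q : MonSig n i → Prop)
    (p : MvPolynomial (Fin n) K) : Prop :=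
  ∃ g ∈ active m G, ∃ t, t + m.degree g.poly = m.degree p ∧ Q (g.sig.mul t)

/-- Coefficient 0 leaves two cases: in `I_i` one of the first `i` generators reduces `p`, from a
lower position; otherwise `ih` applies at a smaller signature. `ih` is a hypothesis because the
argument is needed both inside the induction for `topReducible_le` and after it. -/
theorem topReducible_lt_of_forall_lt (hB : BasisInvariant m F G)
    (hgb : IsGroebnerBasis m (initialGens F) (Ideal.span (initialGens F))) {σ : Fin n →₀ ℕ}
    (ih : ∀ τ, τ ≺[m] σ → ∀ (c : K) p, p ≠ 0 → TopCoeff m F τ c p →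
      TopReducible m G (MonSig.LE m · ⟨τ, Fin.last i⟩) p)
    {p : MvPolynomial (Fin n) K} (hp : p ≠ 0) (h : TopCoeff m F σ 0 p) :
    TopReducible m G (MonSig.LT m · ⟨σ, Fin.last i⟩) p := by
  rcases h.mem_or_exists_lt with hm | ⟨τ, c, hτ, hc⟩
  · obtain ⟨-, ⟨j, rfl⟩, -, hd⟩ := hgb.2 p hm hp
    exact ⟨_, hB.generator_mem j.castSucc, _, tsub_add_cancel_of_le hd,
      .inl (Fin.castSucc_lt_last j)⟩
  · obtain ⟨g, hg, t, ht, hle⟩ := ih τ hτ c p hp hc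
    refine ⟨g, hg, t, ht, ?_⟩
    rcases hle with he | hl | ⟨he, hl⟩
    · exact .inr ⟨by rw [he], by rw [he]; exact hτ⟩
    · exact .inl hl
    · exact .inr ⟨he, hl.trans hτ⟩

/-- If all critical pairs up to `σ` are processed, every polynomial with signature at most `σ` is
top-reducible. -/
theorem topReducible_le (hB : BasisInvariant m F G)
    (hgb : IsGroebnerBasis m (initialGens F) (Ideal.span (initialGens F))) {σ : Fin n →₀ ℕ}
    (hproc : ∀ x, IsCritPair m G x → x.mon ≼[m] σ → Processed m G x) {c : K}
    {p : MvPolynomial (Fin n) K} (hp : p ≠ 0) (h : TopCoeff m F σ c p) :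
    TopReducible m G (MonSig.LE m · ⟨σ, Fin.last i⟩) p := by
  induction hs : m.toSyn σ using WellFoundedLT.induction generalizing σ c p with
  | ind s ih =>
  subst hs
  have hlow {q : MvPolynomial (Fin n) K} (hq : q ≠ 0) (h : TopCoeff m F σ 0 q) :
      TopReducible m G (MonSig.LT m · ⟨σ, Fin.last i⟩) q :=
    topReducible_lt_of_forall_lt hB hgb (fun τ hτ c p hp hc =>
      ih _ hτ (fun x hx hxτ => hproc x hx (hxτ.trans hτ.le)) hp hc rfl) hq h
  have weaken {q : MvPolynomial (Fin n) K} :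
      TopReducible m G (MonSig.LT m · ⟨σ, Fin.last i⟩) q →
        TopReducible m G (MonSig.LE m · ⟨σ, Fin.last i⟩) q :=
    fun ⟨g, hg, t, ht, hlt⟩ => ⟨g, hg, t, ht, .inr hlt⟩
  -- Among the multiples of active elements with signature `σ`, take one of least degree.
  let A : Set (Labeled K n i × (Fin n →₀ ℕ)) :=
    {y | y.1 ∈ active m G ∧ y.1.sig.mul y.2 = ⟨σ, Fin.last i⟩}
  have hA : A.Nonempty :=
    ⟨(⟨⟨0, Fin.last i⟩, F (Fin.last i)⟩, σ), hB.generator_mem _, by simp [MonSig.mul]⟩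
  obtain ⟨⟨g, t⟩, ⟨hg, hgσ⟩, hmin⟩ := WellFounded.has_min
    (InvImage.wf (fun y : Labeled K n i × (Fin n →₀ ℕ) => m.toSyn (y.2 + m.degree y.1.poly))
      wellFounded_lt) A hA
  dsimp only at hg hgσ
  have hg0 := ne_zero_of_mem_active hg
  have hgi : g.sig.idx = Fin.last i := congrArg MonSig.idx hgσ
  have hgt : t + g.sig.mon = σ := congrArg MonSig.mon hgσ
  have hmin' (a : Labeled K n i) (ha : a ∈ active m G) (hi : a.sig.idx = Fin.last i)
      (u : Fin n →₀ ℕ) (hu : u + a.sig.mon = σ) :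
      t + m.degree g.poly ≼[m] u + m.degree a.poly :=
    not_lt.mp (hmin (a, u) ⟨ha, by rw [MonSig.mul, hu, hi]⟩)
  have hgc : ∀ b, TopCoeff m F σ b (monomial t b * g.poly) := fun b => by
    simpa using (hB.isSignature g (mem_of_mem_active hg)).topCoeff_monomial_mul_of_eq hgσ b
  by_cases hred : TopReducible m G (MonSig.LT m · ⟨σ, Fin.last i⟩) (monomial t 1 * g.poly)
  · -- The critical pair of `g` and its reducer yields a syzygy with signature `σ`.
    obtain ⟨g', hg', t', ht', hlt⟩ := hred
    rw [degree_monomial_mul one_ne_zero _ hg0] at ht'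
    have hdvd : lcmLM m g.poly g'.poly ≤ t + m.degree g.poly :=
      sup_le le_add_self (ht' ▸ le_add_self)
    obtain ⟨v, hv⟩ := exists_add_of_le hdvd
    have hvt : v + cofactor m g.poly g'.poly = t := by
      apply add_right_cancel (b := m.degree g.poly)
      rw [add_assoc, cofactor_add_degree, hv, add_comm]
    have hvt' : v + cofactor m g'.poly g.poly = t' := by
      apply add_right_cancel (b := m.degree g'.poly)
      rw [add_assoc, cofactor_add_degree, lcmLM_comm, ht', hv, add_comm]
    have hor : IsOrientedPair m g g'
        ⟨cofactor m g.poly g'.poly + g.sig.mon, g.poly, g'.poly⟩ := by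
      refine ⟨hgi, ?_, rfl⟩
      rcases hlt with hlt | ⟨he, hlt⟩
      · exact .inl (hgi ▸ hlt)
      · refine .inr ⟨he.trans hgi.symm, ?_⟩
        simp only [MonSig.mul, ← hvt', ← hgt, ← hvt, add_assoc, map_add] at hlt ⊢
        exact lt_of_add_lt_add_left hlt
    have hvσ : v + (cofactor m g.poly g'.poly + g.sig.mon) = σ := by
      rw [← add_assoc, hvt, hgt]
    obtain ⟨r, hrG, hr⟩ := hproc _ ⟨g, hg, g', hg', hor⟩
      (m.toSyn_monotone (hvσ ▸ le_add_self))
    dsimp only at hrG hr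
    -- If `r = 0`, then `v r = 0` has signature `σ` with coefficient 1, and subtracting `c` times it
    -- shows that `p` itself has coefficient 0 at `σ`.
    by_cases hr0 : r = 0
    · subst hr0
      refine weaken (hlow hp ?_)
      have h0 := (hB.isSignature _ hrG).topCoeff_monomial_mul_of_eq (t := v) (σ := σ)
        (by simp only [MonSig.mul, hvσ]) c
      simpa using h.sub h0
    -- The multiple `v w a` has signature `σ`, and its leading monomial is at most that of `v r`,
    -- hence below `v` times the lcm, which is that of `t g`: this contradicts the choice of `t g`.
    · obtain ⟨a, ha, hai, w, hw, hwd⟩ := hB.dominated _ hrG rfl hr0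
      dsimp only at hw hwd
      have h₁ := hmin' a ha hai (v + w) (by rw [add_assoc, hw, hvσ])
      have h₂ := hwd.trans_lt (hr.resolve_left hr0)
      refine absurd h₁ (not_le_of_gt ?_)
      rw [hv, add_assoc, add_comm (lcmLM m _ _), map_add, map_add m.toSyn v]
      exact add_lt_add_right h₂ _
  -- Now `t g` is irreducible below `σ`. If its leading monomial differs from that of `p`, then `p -
  -- c t g` keeps the larger of the two; the reducer from `hlow` rules out that of `t g` and so
  -- reduces `p`.
  · by_cases hle : t + m.degree g.poly = m.degree p
    · exact ⟨g, hg, t, hle, .inl hgσ⟩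
    have hq : TopCoeff m F σ 0 (p - monomial t c * g.poly) := by simpa using h.sub (hgc c)
    by_cases hc : c = 0
    · exact weaken (hlow hp (hc ▸ h))
    have hdeg := degree_monomial_mul (m := m) hc t hg0
    have hne : m.degree (monomial t c * g.poly) ≠ m.degree p := hdeg ▸ hle
    have hq0 : p - monomial t c * g.poly ≠ 0 := fun h0 => hne (by rw [sub_eq_zero.mp h0])
    obtain ⟨g', hg', t', ht', hlt⟩ := hlow hq0 hq
    rcases lt_or_gt_of_ne (m.toSyn.injective.ne hne) with hl | hl
    · rw [m.degree_sub_of_lt hl] at ht'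
      exact ⟨g', hg', t', ht', .inr hlt⟩
    · refine absurd ⟨g', hg', t', ?_, hlt⟩ hred
      rw [ht', ← neg_sub, m.degree_neg, m.degree_sub_of_lt hl, hdeg,
        degree_monomial_mul one_ne_zero _ hg0]

/-- For coefficient 0, only pairs strictly below `σ` need to be processed, which is all that is
known while a pair of signature `σ` is being reduced. -/
theorem topReducible_lt (hB : BasisInvariant m F G)
    (hgb : IsGroebnerBasis m (initialGens F) (Ideal.span (initialGens F))) {σ : Fin n →₀ ℕ}
    (hproc : ∀ x, IsCritPair m G x → x.mon ≺[m] σ → Processed m G x)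
    {p : MvPolynomial (Fin n) K} (hp : p ≠ 0) (h : TopCoeff m F σ 0 p) :
    TopReducible m G (MonSig.LT m · ⟨σ, Fin.last i⟩) p :=
  topReducible_lt_of_forall_lt hB hgb (fun _ hτ _ _ hp hc =>
    topReducible_le hB hgb (fun x hx hxτ => hproc x hx (hxτ.trans_lt hτ)) hp hc) hp h

/-! ### Invariance -/

theorem IsSignature.C_inv_mul {σ : Fin n →₀ ℕ} {c : K} {r : MvPolynomial (Fin n) K}
    (h : IsSignature m F c ⟨σ, Fin.last i⟩ r) :
    IsSignature m F 1 ⟨σ, Fin.last i⟩ (C c⁻¹ * r) := by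
  obtain ⟨hc, h⟩ := isSignature_last_iff.mp h
  refine isSignature_last_iff.mpr ⟨one_ne_zero, ?_⟩
  simpa [hc] using h.monomial_mul 0 c⁻¹

theorem degree_C_mul {c : K} (hc : c ≠ 0) (r : MvPolynomial (Fin n) K) :
    m.degree (C c * r) = m.degree r := by
  by_cases hr : r = 0
  · simp [hr]
  · simpa using degree_monomial_mul (m := m) hc 0 hr

/-- Appending the result of a semi-complete reduction preserves the invariant of the basis. -/
theorem BasisInvariant.append (hB : BasisInvariant m F G)
    (hgb : IsGroebnerBasis m (initialGens F) (Ideal.span (initialGens F))) {σ : Fin n →₀ ℕ}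
    (hproc : ∀ x, IsCritPair m G x → x.mon ≺[m] σ → Processed m G x) {c : K}
    {r : MvPolynomial (Fin n) K} (hr : IsSignature m F c ⟨σ, Fin.last i⟩ r)
    (hirr : ¬ ∃ r', ReducesA m G ⟨σ, Fin.last i⟩ r r') :
    BasisInvariant m F (⟨⟨σ, Fin.last i⟩, C c⁻¹ * r⟩ :: G) := by
  have hc : c⁻¹ ≠ 0 := inv_ne_zero (isSignature_last_iff.mp hr).1
  have hdeg : m.degree (C c⁻¹ * r) = m.degree r := degree_C_mul hc r
  have hr1 := hr.C_inv_mul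
  have mono {g : Labeled K n i} (hg : g ∈ active m G) :
      g ∈ active m (⟨⟨σ, Fin.last i⟩, C c⁻¹ * r⟩ :: G) := mem_active_cons.mpr (.inr hg)
  refine ⟨?_, fun j => mono (hB.generator_mem j), ?_, ?_⟩
  · rintro g hg
    rcases List.mem_cons.mp hg with rfl | hg
    · exact hr1
    · exact hB.isSignature g hg
  · rintro g hg hi h0
    rcases List.mem_cons.mp hg with rfl | hg
    · by_cases hred : Redundant m G ⟨⟨σ, Fin.last i⟩, C c⁻¹ * r⟩
      · obtain ⟨-, b, hb, hbi, hb0, hbσ, hbd⟩ := hred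
        obtain ⟨a, ha, hai, w, hw, hwd⟩ := hB.dominated b hb hbi hb0
        obtain ⟨v, hv⟩ := exists_add_of_le hbσ
        obtain ⟨u, hu⟩ := exists_add_of_le hbd
        dsimp only at hv hu h0 ⊢
        refine ⟨a, mono ha, hai, v + w, by rw [add_assoc, hw, hv, add_comm], ?_⟩
        -- Otherwise `u` times the signature of `b` would lie below `v` times it, which is `σ`, so
        -- `b` would give a type (A) reduction of `r`.
        have hvu : v ≼[m] u := by
          by_contra hlt
          refine hirr (exists_reducesA hb hb0 (right_ne_zero_of_mul h0) (t := u) ?_ ?_)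
          · rw [← hdeg, hu, add_comm]
          · refine (MonSig.lt_last_iff (s := b.sig.mul u) hbi).mpr ?_
            simp only [MonSig.mul, hv, add_comm b.sig.mon, map_add]
            exact add_lt_add_left (not_le.mp hlt) _
        rw [hu, add_assoc, add_comm (m.degree b.poly), map_add, map_add m.toSyn u]
        exact add_le_add hvu hwd
      · exact ⟨_, mem_active_cons.mpr (.inl ⟨rfl, h0, hred⟩), rfl, 0, zero_add _,
          by rw [zero_add]⟩
    · obtain ⟨a, ha, h⟩ := hB.dominated g hg hi h0
      exact ⟨a, mono ha, h⟩
  · rintro g hg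
    rcases mem_active_cons.mp hg with ⟨rfl, h0, -⟩ | hg
    · refine ⟨⟨1, hr1⟩, fun d t ht => ?_⟩
      dsimp only at h0 ht ⊢
      -- A smaller signature would give `r` coefficient 0 at `σ`, hence a type (A) reducer.
      rcases MonSig.lt_trichotomy (m := m) t ⟨σ, Fin.last i⟩ with hlt | rfl | hlt
      · obtain ⟨g, hg, u, hu, hlt'⟩ := topReducible_lt hB hgb hproc h0 (ht.topCoeff_of_lt hlt)
        exact absurd (exists_reducesA (mem_of_mem_active hg) (ne_zero_of_mem_active hg)
          (right_ne_zero_of_mul h0) (hu.trans hdeg) hlt') hirr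
      · exact .inl rfl
      · exact .inr hlt
    · exact hB.minimal g hg

/-- All critical pairs of `G` are pending, i.e. in `Q`, or processed. -/
structure PairInvariant (m : MonomialOrder (Fin n)) (G : List (Labeled K n i))
    (Q : Set (CritPair K n)) : Prop where
  isCritPair : ∀ x ∈ Q, IsCritPair m G x
  complete : ∀ x, IsCritPair m G x → x ∈ Q ∨ Processed m G x

/-- The invariant of the algorithm. -/
def StateInvariant (m : MonomialOrder (Fin n)) (F : Fin (i + 1) → MvPolynomial (Fin n) K) :
    State K n i → Prop
  | .outer G P => BasisInvariant m F G ∧ PairInvariant m G P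
  | .inner G P S d => BasisInvariant m F G ∧ PairInvariant m G (P ∪ S) ∧
      (∀ x ∈ P, d < x.mon.degree) ∧ ∀ x ∈ S, x.mon.degree = d
  | .reducing G P S d σ c r => BasisInvariant m F G ∧
      (∀ x ∈ P, d < x.mon.degree) ∧ (∀ x ∈ S, x.mon.degree = d) ∧
      (∀ x ∈ S, σ ≼[m] x.mon) ∧ σ.degree = d ∧
      IsSignature m F c ⟨σ, Fin.last i⟩ r ∧
      -- The pair under reduction still counts as pending; the bound on `r` is what will make it
      -- processed when `r` is appended.
      ∃ x : CritPair K n, x.mon = σ ∧ PairInvariant m G (insert x (P ∪ S)) ∧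
        (r = 0 ∨ m.degree r ≺[m] lcmLM m x.left x.right)

theorem DegreeCompatible.degree_le (hm : DegreeCompatible m) {a b : Fin n →₀ ℕ}
    (h : a ≼[m] b) : a.degree ≤ b.degree := by
  by_contra hlt
  exact absurd h (not_le_of_gt (hm _ _ (not_le.mp hlt)))

theorem stateInvariant_initial (hF : ∀ j, F j ∉ Ideal.span (F '' {k | k < j})) :
    StateInvariant m F (initial m F) := by
  have hF0 : ∀ j, F j ≠ 0 := fun j h0 => hF j (h0 ▸ Ideal.zero_mem _)
  have hG : (List.ofFn fun j => (⟨⟨0, j⟩, F j⟩ : Labeled K n i)).reverse =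
      ⟨⟨0, Fin.last i⟩, F (Fin.last i)⟩ ::
        (List.ofFn fun j : Fin i => (⟨⟨0, j.castSucc⟩, F j.castSucc⟩ : Labeled K n i)).reverse := by
    rw [List.ofFn_succ', List.concat_eq_append, List.reverse_append]
    rfl
  have hlow : ∀ g ∈ (List.ofFn fun j : Fin i =>
      (⟨⟨0, j.castSucc⟩, F j.castSucc⟩ : Labeled K n i)).reverse,
      g.poly ≠ 0 ∧ g.sig.idx ≠ Fin.last i := by
    intro g hg
    obtain ⟨j, rfl⟩ := List.mem_ofFn.mp (List.mem_reverse.mp hg)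
    exact ⟨hF0 _, (Fin.castSucc_lt_last j).ne⟩
  -- Redundancy concerns only the last position, where `F (Fin.last i)` has no predecessor, so every
  -- initial element is active.
  have hact : active m (List.ofFn fun j => (⟨⟨0, j⟩, F j⟩ : Labeled K n i)).reverse =
      (List.ofFn fun j => (⟨⟨0, j⟩, F j⟩ : Labeled K n i)).reverse := by
    rw [hG, active, if_pos ⟨hF0 _, fun ⟨_, g, hg, hi, _⟩ => (hlow g hg).2 hi⟩,
      active_eq_self hlow]
  have hmem {g : Labeled K n i} :
      g ∈ (List.ofFn fun j => (⟨⟨0, j⟩, F j⟩ : Labeled K n i)).reverse ↔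
        ∃ j, (⟨⟨0, j⟩, F j⟩ : Labeled K n i) = g := by
    rw [List.mem_reverse, List.mem_ofFn]
  refine ⟨⟨?_, ?_, ?_, ?_⟩, ?_, ?_⟩
  · intro g hg
    obtain ⟨j, rfl⟩ := hmem.mp hg
    exact (isMinSignature_generator hF j).1
  · intro j
    rw [hact]
    exact hmem.mpr ⟨j, rfl⟩
  · intro g hg hi _
    rw [hact]
    exact ⟨g, hg, hi, 0, zero_add _, by rw [zero_add]⟩
  · intro g hg
    rw [hact] at hg
    obtain ⟨j, rfl⟩ := hmem.mp hg
    exact (isMinSignature_generator hF j).2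
  · intro x hx
    obtain ⟨j, -, rfl⟩ := Finset.mem_image.mp (Finset.mem_coe.mp hx)
    refine ⟨⟨⟨0, Fin.last i⟩, F (Fin.last i)⟩, ?_, ⟨⟨0, j.castSucc⟩, F j.castSucc⟩, ?_, rfl,
      .inl (Fin.castSucc_lt_last j), by simp⟩ <;> rw [hact] <;> exact hmem.mpr ⟨_, rfl⟩
  · rintro x ⟨p, hp, q, hq, hi, hlt, rfl⟩
    rw [hact] at hp hq
    obtain ⟨j, rfl⟩ := hmem.mp hp
    obtain ⟨k, rfl⟩ := hmem.mp hq
    obtain rfl : j = Fin.last i := hi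
    rcases Fin.eq_castSucc_or_eq_last k with ⟨k, rfl⟩ | rfl
    · exact .inl (Finset.mem_coe.mpr (Finset.mem_image.mpr ⟨k, Finset.mem_univ _, by simp⟩))
    · exact absurd hlt (MonSig.lt_irrefl _)

theorem StateInvariant.step (hm : DegreeCompatible m)
    (hgb : IsGroebnerBasis m (initialGens F) (Ideal.span (initialGens F)))
    {s t : State K n i} (hs : StateInvariant m F s) (h : Step m s t) : StateInvariant m F t := by
  cases h with
  | select G P d hd hmin =>
    obtain ⟨hB, hP⟩ := hs
    refine ⟨hB, ?_, fun x hx => ?_, fun x hx => (Finset.mem_filter.mp hx).2⟩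
    · convert hP using 1
      ext x
      simp only [Set.mem_union, Finset.mem_coe, Finset.mem_filter]
      tauto
    · obtain ⟨hx, hne⟩ := Finset.mem_filter.mp hx
      exact lt_of_le_of_ne (hmin x hx) (Ne.symm hne)
  | pick G P S d x hx hmin =>
    obtain ⟨hB, hP, hPd, hSd⟩ := hs
    obtain ⟨p, hp, q, hq, hpq⟩ := hP.isCritPair x (.inr hx)
    refine ⟨hB, hPd, fun y hy => hSd y (Finset.mem_of_mem_erase hy),
      fun y hy => hmin y (Finset.mem_of_mem_erase hy), hSd x hx,
      hpq.isSignature (hB.isSignature p (mem_of_mem_active hp))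
        (hB.isSignature q (mem_of_mem_active hq)), x, rfl, ?_, ?_⟩
    · convert hP using 1
      ext y
      simp only [Set.mem_insert_iff, Set.mem_union, Finset.mem_coe, Finset.mem_erase]
      by_cases hy : y = x
      · simp [hy, hx]
      · simp [hy]
    · obtain ⟨-, -, rfl⟩ := hpq
      exact spoly_eq_zero_or_degree_lt (ne_zero_of_mem_active hp) (ne_zero_of_mem_active hq)
  | reduceA G P S d σ c r r' h =>
    obtain ⟨hB, hPd, hSd, hSσ, hσ, hr, x, hx, hP, hrd⟩ := hs
    obtain ⟨h0, g, hg, a, u, hu, hlt, rfl⟩ := h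
    rw [monomial_mul_leadingTerm] at hu
    refine ⟨hB, hPd, hSd, hSσ, hσ, ?_, x, hx, hP, ?_⟩
    · obtain ⟨hc, hr⟩ := isSignature_last_iff.mp hr
      refine isSignature_last_iff.mpr ⟨hc, ?_⟩
      simpa using hr.sub ((hB.isSignature g hg).topCoeff_monomial_mul_of_lt hlt a)
    · exact (sub_eq_zero_or_degree_lt hu).imp_right fun h => h.trans (hrd.resolve_left h0)
  | reduceB G P S d σ c c' r r' h =>
    obtain ⟨hB, hPd, hSd, hSσ, hσ, hr, x, hx, hP, hrd⟩ := hs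
    obtain ⟨h0, g, hg, a, u, hu, heq, hac, rfl, rfl⟩ := h
    rw [monomial_mul_leadingTerm] at hu
    refine ⟨hB, hPd, hSd, hSσ, hσ, ?_, x, hx, hP, ?_⟩
    · obtain ⟨hc, hr⟩ := isSignature_last_iff.mp hr
      refine isSignature_last_iff.mpr ⟨sub_ne_zero.mpr hac.symm, ?_⟩
      simpa using hr.sub ((hB.isSignature g hg).topCoeff_monomial_mul_of_eq heq a)
    · exact (sub_eq_zero_or_degree_lt hu).imp_right fun h => h.trans (hrd.resolve_left h0)
  | append G P S d σ c r h =>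
    obtain ⟨hB, hPd, hSd, hSσ, hσ, hr, x, hx, hP, hrd⟩ := hs
    -- No pending pair lies below `σ`: those in `P` have larger degree, hence larger monomials by
    -- degree compatibility, and those in `S` are bounded below by the minimal choice of `σ`.
    have hproc : ∀ y, IsCritPair m G y → y.mon ≺[m] σ → Processed m G y := by
      intro y hy hlt
      refine (hP.complete y hy).resolve_left ?_
      rintro (rfl | hy | hy)
      · exact absurd hlt (hx ▸ lt_irrefl _)
      · exact absurd hlt (hm _ _ (hσ ▸ hPd y hy)).not_gt
      · exact absurd hlt (hSσ y hy).not_gt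
    have hnew {y : CritPair K n} (hy : y ∈ newPairs m G σ (C c⁻¹ * r)) : d ≤ y.mon.degree :=
      hσ ▸ hm.degree_le (le_of_mem_newPairs hy)
    have hunion (y : CritPair K n) :
        y ∈ ((P ∪ (newPairs m G σ (C c⁻¹ * r)).filter fun x => x.mon.degree ≠ d : Finset _) ∪
          (S ∪ (newPairs m G σ (C c⁻¹ * r)).filter fun x => x.mon.degree = d : Finset _) :
            Set (CritPair K n)) ↔ (y ∈ P ∨ y ∈ S) ∨ y ∈ newPairs m G σ (C c⁻¹ * r) := by
      simp only [Set.mem_union, Finset.mem_coe, Finset.mem_union, Finset.mem_filter]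
      tauto
    refine ⟨hB.append hgb hproc hr h, ⟨fun y hy => ?_, fun y hy => ?_⟩, fun y hy => ?_,
      fun y hy => ?_⟩
    · rw [hunion] at hy
      refine isCritPair_cons_iff.mpr (hy.imp_left fun hy => hP.isCritPair y (.inr hy))
    · rw [hunion]
      rcases isCritPair_cons_iff.mp hy with hy | hy
      · rcases hP.complete y hy with (rfl | hy) | hy
        · refine .inr ⟨_, by rw [hx]; exact List.mem_cons_self, ?_⟩
          have hc : c⁻¹ ≠ 0 := inv_ne_zero (isSignature_last_iff.mp hr).1
          rw [degree_C_mul hc]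
          exact hrd.imp_left fun h0 => by rw [h0, mul_zero]
        · exact .inl (.inl hy)
        · exact .inr (hy.cons _)
      · exact .inl (.inr hy)
    · rcases Finset.mem_union.mp hy with hy | hy
      · exact hPd y hy
      · obtain ⟨hy, hne⟩ := Finset.mem_filter.mp hy
        exact lt_of_le_of_ne (hnew hy) (Ne.symm hne)
    · rcases Finset.mem_union.mp hy with hy | hy
      · exact hSd y hy
      · exact (Finset.mem_filter.mp hy).2
  | leave G P d =>
    obtain ⟨hB, hP, -⟩ := hs
    refine ⟨hB, ?_⟩
    simpa using hP

theorem Reachable.stateInvariant (hm : DegreeCompatible m)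
    (hgb : IsGroebnerBasis m (initialGens F) (Ideal.span (initialGens F)))
    (hF : ∀ j, F j ∉ Ideal.span (F '' {k | k < j})) {s : State K n i}
    (h : Reachable m F s) : StateInvariant m F s := by
  induction h with
  | refl => exact stateInvariant_initial hF
  | tail _ hst ih => exact ih.step hm hgb hst

/-! ### The output -/

theorem mem_output {g : Labeled K n i} : g ∈ output m G ↔ g ∈ active m G :=
  List.mem_toFinset

/-- If top reductions below the signature `σ` always exist, they add up to a representation. -/
theorem exists_representation (hB : BasisInvariant m F G) {σ : Fin n →₀ ℕ}
    (hred : ∀ (c : K) p, p ≠ 0 → TopCoeff m F σ c p →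
      TopReducible m G (MonSig.LE m · ⟨σ, Fin.last i⟩) p) {c : K}
    {p : MvPolynomial (Fin n) K} (h : TopCoeff m F σ c p) :
    ∃ h : Labeled K n i → MvPolynomial (Fin n) K,
      p = ∑ g ∈ output m G, h g * g.poly ∧
      ∀ g ∈ output m G, h g = 0 ∨
        (p ≠ 0 ∧ m.degree (h g) + m.degree g.poly ≼[m] m.degree p ∧
          (g.sig.mul (m.degree (h g))).LE m ⟨σ, Fin.last i⟩) := by
  induction hs : m.toWithBotSyn (m.withBotDegree p) using WellFoundedLT.induction
    generalizing c p with
  | ind s ih =>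
  subst hs
  by_cases hp : p = 0
  · exact ⟨0, by simp [hp], fun g _ => .inl rfl⟩
  obtain ⟨g, hg, t, ht, hle⟩ := hred c p hp h
  have hg0 := ne_zero_of_mem_active hg
  set a := m.leadingCoeff p / m.leadingCoeff g.poly with ha
  have ha0 : a ≠ 0 :=
    div_ne_zero (m.leadingCoeff_ne_zero_iff.mpr hp) (m.leadingCoeff_ne_zero_iff.mpr hg0)
  have hlt : m.leadingTerm (monomial t a * g.poly) = m.leadingTerm p := by
    rw [leadingTerm_monomial_mul, ht, ha, div_mul_cancel₀ _ (m.leadingCoeff_ne_zero_iff.mpr hg0),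
      MonomialOrder.leadingTerm]
  have hsig := hB.isSignature g (mem_of_mem_active hg)
  -- The coefficient at `σ` may change or vanish after the subtraction; only the bound `σ` has to
  -- persist, which is why `hred` and the induction allow any `c`.
  obtain ⟨d, hd⟩ : ∃ d, TopCoeff m F σ d (monomial t a * g.poly) := by
    rcases hle with he | hl
    · exact ⟨_, hsig.topCoeff_monomial_mul_of_eq he a⟩
    · exact ⟨_, hsig.topCoeff_monomial_mul_of_lt hl a⟩
  obtain ⟨k, hk, hkd⟩ := ih _ (withBotDegree_sub_lt hp hlt) (h.sub hd) rfl
  refine ⟨fun y => k y + if y = g then monomial t a else 0, ?_, fun y hy => ?_⟩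
  · simp only [add_mul, Finset.sum_add_distrib, ← hk, ite_mul, zero_mul, Finset.sum_ite_eq',
      mem_output, hg, if_true, sub_add_cancel]
  -- Strictness matters: if `g` is used again, its later multiplier lies below `t`, so `t` remains
  -- the leading monomial of the combined multiplier.
  · have hkd' : k y = 0 ∨ (m.degree (k y) + m.degree y.poly ≺[m] m.degree p ∧
        (y.sig.mul (m.degree (k y))).LE m ⟨σ, Fin.last i⟩) := by
      refine (hkd y hy).imp_right fun ⟨h0, h₁, h₂⟩ => ⟨h₁.trans_lt ?_, h₂⟩
      exact (sub_eq_zero_or_degree_lt hlt).resolve_left h0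
    dsimp only
    split_ifs with hyg
    · subst hyg
      have hdeg : m.degree (k y + monomial t a) = t := by
        have hmt : m.degree (monomial t a) = t := by rw [m.degree_monomial, if_neg ha0]
        rcases hkd' with h0 | ⟨h₁, -⟩
        · rw [h0, zero_add, hmt]
        · rw [← ht, map_add, map_add] at h₁
          rw [m.degree_add_eq_right_of_lt (hmt.symm ▸ lt_of_add_lt_add_right h₁), hmt]
      exact .inr ⟨hp, by rw [hdeg, ht], by rwa [hdeg]⟩
    · rw [add_zero]
      exact hkd'.imp_right fun ⟨h₁, h₂⟩ => ⟨hp, h₁.le, h₂⟩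

theorem output_correct (hB : BasisInvariant m F G)
    (hgb : IsGroebnerBasis m (initialGens F) (Ideal.span (initialGens F)))
    (hproc : ∀ x, IsCritPair m G x → Processed m G x) :
    SignatureCriterion m F (output m G) ∧
      IsGroebnerBasis m {f | ∃ g ∈ output m G, g.poly = f} (Ideal.span (Set.range F)) := by
  have hred (σ : Fin n →₀ ℕ) (c : K) (p) (hp : p ≠ 0) (h : TopCoeff m F σ c p) :
      TopReducible m G (MonSig.LE m · ⟨σ, Fin.last i⟩) p :=
    topReducible_le hB hgb (fun x hx _ => hproc x hx) hp h
  have hmem : ∀ g ∈ output m G, g.poly ∈ Ideal.span (Set.range F) := fun g hg =>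
    (hB.isSignature g (mem_of_mem_active (mem_output.mp hg))).mem_span
  refine ⟨⟨fun g hg => ne_zero_of_mem_active (mem_output.mp hg), hmem, ⟨?_, ?_⟩,
    mem_output.mpr (hB.generator_mem _), fun g hg => hB.minimal g (mem_output.mp hg), ?_⟩, ?_, ?_⟩
  · rintro _ ⟨g, hg, hi, rfl⟩
    exact (hB.isSignature g (mem_of_mem_active (mem_output.mp hg))).mem_of_ne_last hi
  · intro p hp hp0
    obtain ⟨_, ⟨j, rfl⟩, h0, hd⟩ := hgb.2 p hp hp0
    exact ⟨_, ⟨_, mem_output.mpr (hB.generator_mem j.castSucc), (Fin.castSucc_lt_last j).ne, rfl⟩,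
      h0, hd⟩
  · intro p hp q hq hi hlt
    rw [mem_output] at hp hq
    have hsig := IsOrientedPair.isSignature (F := F) (x := ⟨_, p.poly, q.poly⟩) ⟨hi, hlt, rfl⟩
      (hB.isSignature p (mem_of_mem_active hp)) (hB.isSignature q (mem_of_mem_active hq))
    have he : p.sig.mul (cofactor m p.poly q.poly) =
      ⟨cofactor m p.poly q.poly + p.sig.mon, Fin.last i⟩ := by rw [MonSig.mul, hi]
    rw [he]
    exact ⟨hsig, exists_representation hB (hred _) (isSignature_last_iff.mp hsig).2⟩
  · rintro _ ⟨g, hg, rfl⟩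
    exact hmem g hg
  · intro p hp hp0
    obtain ⟨σ, c, h⟩ := exists_topCoeff (m := m) hp
    obtain ⟨g, hg, t, ht, -⟩ := hred σ c p hp0 h
    exact ⟨_, ⟨g, mem_output.mpr hg, rfl⟩, ne_zero_of_mem_active hg, ht ▸ le_add_self⟩

end

end SigGB

theorem mainTheorem2 {K : Type*} [Field K] {n i : ℕ}
    (m : MonomialOrder (Fin n)) (hm : SigGB.DegreeCompatible m)
    (F : Fin (i + 1) → MvPolynomial (Fin n) K)
    (hgb : SigGB.IsGroebnerBasis m (SigGB.initialGens F) (Ideal.span (SigGB.initialGens F)))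
    (hF : ∀ j, F j ∉ Ideal.span (F '' {k | k < j})) :
    (¬ ∃ run : ℕ → SigGB.State K n i,
        run 0 = SigGB.initial m F ∧ ∀ k, SigGB.Step m (run k) (run (k + 1))) ∧
    (∀ s : SigGB.State K n i, SigGB.Reachable m F s →
        (∃ t, SigGB.Step m s t) ∨ ∃ G, s = SigGB.State.outer G ∅) ∧
    (∀ G : List (SigGB.Labeled K n i), SigGB.Reachable m F (SigGB.State.outer G ∅) →
        SigGB.SignatureCriterion m F (SigGB.output m G) ∧
        SigGB.IsGroebnerBasis m {f | ∃ g ∈ SigGB.output m G, g.poly = f}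
          (Ideal.span (Set.range F))) := by
  refine ⟨fun ⟨run, _, h⟩ => SigGB.not_exists_infinite_run ⟨run, h⟩,
    fun s _ => SigGB.exists_step_or_eq_outer s, fun G hG => ?_⟩
  obtain ⟨hB, hP⟩ := hG.stateInvariant hm hgb hF
  exact SigGB.output_correct hB hgb fun x hx => (hP.complete x hx).resolve_left (by simp)
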